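/- Let $D$ be the open unit disc and, for $0\le r<1$, let $\Phi_r(\theta)=\dfrac{1-r^2}{2\pi(1-2r\cos\theta+r^2)}$ be the Poisson kernel. All integrals are Henstock--Kurzweil integrals. For $f:\mathbb R\to\mathbb R$ let $\|f\|=\sup_I\left|\int_I f\right|$ be the Alexiewicz norm, the supremum being over all intervals $I\subset\mathbb R$ of length at most $2\pi$ (with $\|f\|=\infty$ if one of these integrals does not exist). Let $\mathcal{HK}$ be the set of $2\pi$-periodic functions $f:\mathbb R\to\mathbb R$ with $\|f\|<\infty$. Let $f\in\mathcal{HK}$. Then the Poisson integral $u_r(\theta)=P[f](re^{i\theta})=\int_{-\pi}^{\pi}f(\phi)\,\Phi_r(\phi-\theta)\,d\phi$ exists for all $0\le r<1$ and $\theta\in\mathbb R$, and (a) $\|u_r\|\le\|f\|$ for all $0\le r<1$, i.e. $\sup_{0\le r<1}\|u_r\|\le\|f\|$; (b) $\|u_r-f\|\to0$ as $r\to1^-$; (c) the decay in (b) can be arbitrarily slow: for every decreasing (not necessarily strictly) function $A:[0,1)\to\mathbb R$ with $A(r)\to0$ as $r\to1^-$ there is $f\in\mathcal{HK}$ such that $u_r=P[f](re^{i\,\cdot})$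 satisfies $\|u_r-f\|\ge A(r)$ for all $0\le r<1$. -/

import Mathlib

open Set Filter
open scoped Topology ENNReal

noncomputable section

/-- The compact interval from `a` to `b`, as a one-dimensional box. -/
def hkBox (a b : ℝ) (h : a < b) : BoxIntegral.Box (Fin 1) where
  lower := fun _ => a
  upper := fun _ => b
  lower_lt_upper := fun _ => h

/-- Henstock--Kurzweil integrability of `f : ℝ → ℝ` on `[a, b]`: the Riemann sums over tagged
partitions of `[a, b]`, with each tag in its own closed subinterval, converge along gauges. -/
def HKIntegrable (f : ℝ → ℝ) (a b : ℝ) (h : a < b) : Prop :=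
  BoxIntegral.Integrable (hkBox a b h) BoxIntegral.IntegrationParams.Henstock
    (fun x : Fin 1 → ℝ => f (x 0)) BoxIntegral.BoxAdditiveMap.volume

/-- The Henstock--Kurzweil integral of `f` over `[a, b]` (equal to `0` if it does not exist). -/
def hkIntegral (f : ℝ → ℝ) (a b : ℝ) (h : a < b) : ℝ :=
  BoxIntegral.integral (hkBox a b h) BoxIntegral.IntegrationParams.Henstock
    (fun x : Fin 1 → ℝ => f (x 0)) BoxIntegral.BoxAdditiveMap.volume

open Classical in
/-- The Alexiewicz norm on the circle, with values in `[0, ∞]`: the supremum of `|∫_I f|` over the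
intervals `I ⊆ ℝ` of length at most `2π`. An interval on which `f` is not
Henstock--Kurzweil integrable contributes `∞`, so that finiteness of the norm includes the existence
of all these integrals. (Degenerate intervals contribute `0`.) -/
def alexiewiczNorm (f : ℝ → ℝ) : ℝ≥0∞ :=
  ⨆ (a : ℝ) (b : ℝ) (h : a < b) (_ : b - a ≤ 2 * Real.pi),
    if HKIntegrable f a b h then ENNReal.ofReal |hkIntegral f a b h| else ∞

/-- The `2π`-periodic functions with finite Alexiewicz norm. -/
def HKCircle : Set (ℝ → ℝ) :=
  {f | Function.Periodic f (2 * Real.pi) ∧ alexiewiczNorm f < ∞}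

/-- The Poisson kernel `Φ_r(θ)`. -/
def poissonPhi (r θ : ℝ) : ℝ :=
  (1 - r ^ 2) / (2 * Real.pi * (1 - 2 * r * Real.cos θ + r ^ 2))

/-- The interval `[-π, π]` is non-degenerate. -/
theorem neg_pi_lt_pi : -Real.pi < Real.pi := by linarith [Real.pi_pos]

/-- The Poisson integral in polar coordinates: `poissonInt f r θ = P[f](re^{iθ})`, so that
`poissonInt f r` is the function `u_r`. -/
def poissonInt (f : ℝ → ℝ) (r θ : ℝ) : ℝ :=
  hkIntegral (fun φ => f φ * poissonPhi r (φ - θ)) (-Real.pi) Real.pi neg_pi_lt_pi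

end

/-! Everything is read off a primitive. A function `f` of `HKCircle` has a continuous primitive `F`
on the line with `F (x + 2π) = F x + c`, and the Alexiewicz norm of `f` is the supremum of `|F b - F
a|` over `b - a ≤ 2π`. The Saks–Henstock lemma, in the form of domination by a monotone function,
makes this primitive flexible enough to be translated, glued and integrated by parts. Integration by
parts against the smooth kernel gives existence of `u_r` and shows that `u_r` is the derivative of
the convolution `poissonMean F r` (`poissonInt_of_primitive`).

(a) An increment of `poissonMean F r` over `[a, b]` is the average, against a probability density,
of the increments of `F` over the translates of `[a, b]`, each bounded by the norm of `f`.

(b) The norm of `u_r - f` is at most twice the supremum of `|poissonMean F r - F|`. Uniform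
continuity gives `|F (x + φ) - F x| ≤ e + C (1 - cos φ)`, and the Poisson average of `1 - cos φ`
tends to `0`.

(c) Let `f ≥ 0` be Lebesgue integrable with mass at least `2M·2⁻ᵏ` on `(0, ε_k]`. The kernel is at
most `1 / (1 - r)`, so `u_r` has mass at most `4M ε_k / (1 - r)` there. A small `ε_k` makes this at
most `M·2⁻ᵏ` as long as `r < ρ_{k+1}`, where `A ≤ M·2⁻ᵏ` on `[ρ_k, 1)`. The masses on `[0, ε_k]`
then differ by at least `M·2⁻ᵏ ≥ A r`. -/

/-! ### Primitives and the Saks–Henstock lemma. -/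

/-- `F` is a Henstock--Kurzweil primitive of `f` on `[a, b]`: the increments of `F` over short
intervals are approximated by those of the Riemann sums up to the increments of a monotone function
of arbitrarily small total variation. -/
def IsHKPrimitive (f F : ℝ → ℝ) (a b : ℝ) : Prop :=
  ∀ ε > 0, ∃ δ : ℝ → ℝ, (∀ t, 0 < δ t) ∧ ∃ φ : ℝ → ℝ, MonotoneOn φ (Icc a b) ∧ φ b - φ a ≤ ε ∧
    ∀ u t v, a ≤ u → u ≤ t → t ≤ v → v ≤ b → v - u ≤ δ t →
      |f t * (v - u) - (F v - F u)| ≤ φ v - φ u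

/-- The increment of `F` over one-dimensional boxes, as a box-additive function. -/
def boxIncrement (F : ℝ → ℝ) : BoxIntegral.BoxAdditiveMap (Fin 1) ℝ ⊤ :=
  BoxIntegral.BoxAdditiveMap.ofMapSplitAdd (fun J => F (J.upper 0) - F (J.lower 0)) ⊤ (by
    intro I _ i x hx
    obtain rfl : i = 0 := Subsingleton.elim _ _
    rw [BoxIntegral.Box.splitLower_def hx, BoxIntegral.Box.splitUpper_def hx]
    simp [Option.elim'])

theorem box_fin_one_eq_hkBox (J : BoxIntegral.Box (Fin 1)) :
    J = hkBox (J.lower 0) (J.upper 0) (J.lower_lt_upper 0) := by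
  obtain ⟨l, u, h⟩ := J
  simp only [hkBox, BoxIntegral.Box.mk.injEq]
  constructor <;> ext i <;> rw [Subsingleton.elim i 0]

theorem hkBox_le_hkBox {a b u v : ℝ} (h : a < b) (h' : u < v) (hau : a ≤ u) (hvb : v ≤ b) :
    hkBox u v h' ≤ hkBox a b h :=
  BoxIntegral.Box.le_iff_bounds.2 ⟨fun _ => hau, fun _ => hvb⟩

theorem mem_Icc_hkBox {a b : ℝ} (h : a < b) {x : Fin 1 → ℝ} :
    x ∈ BoxIntegral.Box.Icc (hkBox a b h) ↔ a ≤ x 0 ∧ x 0 ≤ b := by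
  simp [hkBox, BoxIntegral.Box.Icc_def, Pi.le_def]

theorem volume_box_fin_one (J : BoxIntegral.Box (Fin 1)) (y : ℝ) :
    (BoxIntegral.BoxAdditiveMap.volume J : ℝ →L[ℝ] ℝ) y = y * (J.upper 0 - J.lower 0) := by
  rw [BoxIntegral.BoxAdditiveMap.volume_apply]
  simp [mul_comm]

/-- Over a partition of `[a, b]` the increments of both `F` and `φ` telescope, so the total error is
at most `φ b - φ a`. -/
theorem IsHKPrimitive.hasIntegral {f F : ℝ → ℝ} {a b : ℝ} (hF : IsHKPrimitive f F a b)
    (h : a < b) :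
    BoxIntegral.HasIntegral (hkBox a b h) BoxIntegral.IntegrationParams.Henstock
      (fun x : Fin 1 → ℝ => f (x 0)) BoxIntegral.BoxAdditiveMap.volume (F b - F a) := by
  refine BoxIntegral.hasIntegral_iff.2 fun ε hε => ?_
  obtain ⟨δ, hδ, φ, hφ, hφε, H⟩ := hF ε hε
  -- Subordination puts a box in the ball of this radius about its tag, so halving `δ` bounds its
  -- length by `δ`.
  refine ⟨fun _ x => ⟨δ (x 0) / 2, half_pos (hδ _)⟩, fun c hc => (Bool.false_ne_true hc).elim, ?_⟩
  intro c π hπ hp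
  have sumF (G : ℝ → ℝ) : ∑ J ∈ π.boxes, (G (J.upper 0) - G (J.lower 0)) = G b - G a :=
    (boxIncrement G).sum_partition_boxes le_top hp
  rw [Real.dist_eq, ← sumF F, BoxIntegral.integralSum, ← Finset.sum_sub_distrib]
  refine (Finset.abs_sum_le_sum_abs _ _).trans (le_trans ?_ hφε)
  rw [← sumF φ]
  refine Finset.sum_le_sum fun J hJ => ?_
  rw [volume_box_fin_one]
  have hJI := BoxIntegral.Box.le_iff_bounds.1 (π.le_of_mem hJ)
  have ht := hπ.isHenstock rfl J hJ
  have hs := hπ.isSubordinate J hJ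
  have h1 := hs J.lower_mem_Icc
  have h2 := hs J.upper_mem_Icc
  rw [Metric.mem_closedBall, dist_pi_le_iff (by exact (half_pos (hδ _)).le)] at h1 h2
  have h1 := abs_le.1 (h1 0)
  have h2 := abs_le.1 (h2 0)
  refine H _ _ _ (hJI.1 0) (ht.1 0) (ht.2 0) (hJI.2 0) ?_
  simp only at h1 h2
  linarith

theorem IsHKPrimitive.integrable {f F : ℝ → ℝ} {a b : ℝ} (hF : IsHKPrimitive f F a b)
    (h : a < b) : HKIntegrable f a b h :=
  (hF.hasIntegral h).integrable

theorem IsHKPrimitive.hkIntegral_eq {f F : ℝ → ℝ} {a b : ℝ} (hF : IsHKPrimitive f F a b)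
    (h : a < b) : hkIntegral f a b h = F b - F a :=
  (hF.hasIntegral h).integral_eq

theorem HKIntegrable.hkIntegral_add {f : ℝ → ℝ} {a b : ℝ} {h : a < b} (hf : HKIntegrable f a b h)
    {u v : ℝ} (hu : a < u) (huv : u < v) (hvb : v ≤ b) :
    hkIntegral f a u hu + hkIntegral f u v huv = hkIntegral f a v (hu.trans huv) := by
  have hle := hkBox_le_hkBox h (hu.trans huv) le_rfl hvb
  have key := (BoxIntegral.Integrable.toBoxAdditive hf).map_split_add
    (WithTop.coe_le_coe.2 hle) 0 u
  have hx : u ∈ Ioo ((hkBox a v (hu.trans huv)).lower 0) ((hkBox a v (hu.trans huv)).upper 0) :=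
    ⟨hu, huv⟩
  have e1 : (hkBox a v (hu.trans huv)).splitLower 0 u = (hkBox a u hu : WithBot _) := by
    rw [BoxIntegral.Box.splitLower_def hx]
    congr 1
    rw [box_fin_one_eq_hkBox (BoxIntegral.Box.mk _ _ _)]
    simp [hkBox]
  have e2 : (hkBox a v (hu.trans huv)).splitUpper 0 u = (hkBox u v huv : WithBot _) := by
    rw [BoxIntegral.Box.splitUpper_def hx]
    congr 1
    rw [box_fin_one_eq_hkBox (BoxIntegral.Box.mk _ _ _)]
    simp [hkBox]
  rw [e1, e2] at key
  exact key

/-- The error of a Riemann sum over a tagged prepartition. -/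
noncomputable def riemannError (f : ℝ → ℝ) {I : BoxIntegral.Box (Fin 1)}
    (π : BoxIntegral.TaggedPrepartition I) : ℝ :=
  BoxIntegral.integralSum (fun x : Fin 1 → ℝ => f (x 0)) BoxIntegral.BoxAdditiveMap.volume π -
    ∑ J ∈ π.boxes, BoxIntegral.integral J BoxIntegral.IntegrationParams.Henstock
      (fun x : Fin 1 → ℝ => f (x 0)) BoxIntegral.BoxAdditiveMap.volume

theorem riemannError_disjUnion (f : ℝ → ℝ) {I : BoxIntegral.Box (Fin 1)}
    (π₁ π₂ : BoxIntegral.TaggedPrepartition I) (h : Disjoint π₁.iUnion π₂.iUnion) :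
    riemannError f (π₁.disjUnion π₂ h) = riemannError f π₁ + riemannError f π₂ := by
  have := BoxIntegral.Prepartition.sum_disj_union_boxes h
    (fun J => BoxIntegral.integral J BoxIntegral.IntegrationParams.Henstock
      (fun x : Fin 1 → ℝ => f (x 0)) BoxIntegral.BoxAdditiveMap.volume)
  simp only [riemannError, BoxIntegral.integralSum_disjUnion]
  simp only [BoxIntegral.TaggedPrepartition.disjUnion_boxes]
  rw [this]
  ring

/-- The tagged prepartition without boxes. -/
def emptyTagged (I : BoxIntegral.Box (Fin 1)) : BoxIntegral.TaggedPrepartition I :=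
  ⟨⊥, fun _ => I.upper, fun _ => I.upper_mem_Icc⟩

theorem notMem_emptyTagged (I J : BoxIntegral.Box (Fin 1)) : J ∉ emptyTagged I := by
  intro h
  exact (BoxIntegral.Prepartition.notMem_bot (I := I) (J := J)) h

/-- One half of the Saks--Henstock estimate: the signed errors of single intervals are dominated by
the increments of a monotone function of small total variation. -/
theorem exists_monotone_of_abs_riemannError_le {f : ℝ → ℝ} {a b : ℝ} {h : a < b}
    {σ : ℝ} (hσ : |σ| = 1) {ε : ℝ}
    {r : (Fin 1 → ℝ) → Ioi (0 : ℝ)}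
    (hr : ∀ π : BoxIntegral.TaggedPrepartition (hkBox a b h),
      π.IsSubordinate r → π.IsHenstock → |riemannError f π| ≤ ε) :
    ∃ φ : ℝ → ℝ, Monotone φ ∧ φ b - φ a ≤ ε ∧
      ∀ u t v, a ≤ u → u ≤ t → t ≤ v → v ≤ b → v - u ≤ r (fun _ => t) → ∀ huv : u < v,
        σ * (f t * (v - u) - hkIntegral f u v huv) ≤ φ v - φ u := by
  -- The majorant at `x` is the supremum of the signed errors of fine prepartitions lying to the
  -- left of `x`. Adjoining `[u, v]` to one that ends before `u` gives one that ends before `v`, so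
  -- the supremum grows by at least the error of `[u, v]`.
  set S : ℝ → Set ℝ := fun x => {s | ∃ π : BoxIntegral.TaggedPrepartition (hkBox a b h),
    π.IsSubordinate r ∧ π.IsHenstock ∧ (∀ J ∈ π, J.upper 0 ≤ x) ∧ s = σ * riemannError f π} with hS
  have hbd : ∀ x, ∀ s ∈ S x, s ≤ ε := by
    rintro x s ⟨π, h1, h2, -, rfl⟩
    refine (le_abs_self _).trans ?_
    rw [abs_mul, hσ, one_mul]
    exact hr π h1 h2
  have hzero : ∀ x, (0 : ℝ) ∈ S x := by
    intro x
    refine ⟨emptyTagged _, fun J hJ => (notMem_emptyTagged _ _ hJ).elim,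
      fun J hJ => (notMem_emptyTagged _ _ hJ).elim,
      fun J hJ => (notMem_emptyTagged _ _ hJ).elim, ?_⟩
    simp [riemannError, BoxIntegral.integralSum, emptyTagged]
  have hbdd : ∀ x, BddAbove (S x) := fun x => ⟨ε, hbd x⟩
  refine ⟨fun x => sSup (S x), ?_, ?_, ?_⟩
  · intro x y hxy
    refine csSup_le_csSup (hbdd y) ⟨0, hzero x⟩ ?_
    rintro s ⟨π, h1, h2, h3, rfl⟩
    exact ⟨π, h1, h2, fun J hJ => (h3 J hJ).trans hxy, rfl⟩
  · have h1 : sSup (S b) ≤ ε := csSup_le ⟨0, hzero b⟩ (hbd b)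
    have h2 : 0 ≤ sSup (S a) := le_csSup (hbdd a) (hzero a)
    simp only
    linarith
  · intro u t v hau hut htv hvb hvu huv
    suffices H : sSup (S u) ≤ sSup (S v) - σ * (f t * (v - u) - hkIntegral f u v huv) by
      simp only
      linarith
    refine csSup_le ⟨0, hzero u⟩ ?_
    rintro s ⟨π, h1, h2, h3, rfl⟩
    rw [le_sub_iff_add_le]
    have htI : (fun _ => t) ∈ BoxIntegral.Box.Icc (hkBox a b h) :=
      (mem_Icc_hkBox h).2 ⟨hau.trans hut, htv.trans hvb⟩
    set π' := BoxIntegral.TaggedPrepartition.single (hkBox a b h) (hkBox u v huv)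
      (hkBox_le_hkBox h huv hau hvb) (fun _ => t) htI with hπ'
    have hd : Disjoint π.iUnion π'.iUnion := by
      rw [hπ', BoxIntegral.TaggedPrepartition.iUnion_single, Set.disjoint_left]
      intro y hy hy'
      obtain ⟨J, hJ, hyJ⟩ := (BoxIntegral.TaggedPrepartition.mem_iUnion _).1 hy
      exact absurd (((hyJ 0).2.trans (h3 J hJ)).trans_lt (hy' 0).1) (lt_irrefl _)
    have herr : riemannError f π' = f t * (v - u) - hkIntegral f u v huv := by
      have hb : π'.boxes = {hkBox u v huv} := rfl
      rw [riemannError, BoxIntegral.integralSum, hb, Finset.sum_singleton, Finset.sum_singleton,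
        volume_box_fin_one]
      rfl
    have hsub : π'.IsSubordinate r := by
      rw [hπ', BoxIntegral.TaggedPrepartition.isSubordinate_single]
      intro y hy
      rw [mem_Icc_hkBox] at hy
      rw [Metric.mem_closedBall, dist_pi_le_iff (by exact (r _).2.le)]
      intro i
      obtain rfl : i = 0 := Subsingleton.elim _ _
      rw [Real.dist_eq, abs_le]
      constructor <;> linarith
    have hhen : π'.IsHenstock := by
      rw [hπ', BoxIntegral.TaggedPrepartition.isHenstock_single_iff]
      exact (mem_Icc_hkBox huv).2 ⟨hut, htv⟩
    refine le_csSup (hbdd v) ⟨π.disjUnion π' hd, h1.disjUnion hsub hd, h2.disjUnion hhen hd, ?_, ?_⟩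
    · intro J hJ
      rcases (BoxIntegral.TaggedPrepartition.mem_disjUnion hd).1 hJ with hJ | hJ
      · exact (h3 J hJ).trans huv.le
      · rw [hπ', BoxIntegral.TaggedPrepartition.mem_single] at hJ
        rw [hJ]
        exact le_rfl
    · rw [riemannError_disjUnion, herr, mul_add]

/-- The indefinite integral is a primitive. -/
theorem HKIntegrable.exists_isHKPrimitive {f : ℝ → ℝ} {a b : ℝ} {h : a < b}
    (hf : HKIntegrable f a b h) : ∃ F, IsHKPrimitive f F a b := by
  -- Boxes are non-degenerate, so the value `0` at `x = a` has to be supplied separately.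
  refine ⟨fun x => if hx : a < x then hkIntegral f a x hx else 0, fun ε hε => ?_⟩
  have hε2 := half_pos hε
  set r := BoxIntegral.Integrable.convergenceR hf (ε / 2) 0
  have hr : ∀ π : BoxIntegral.TaggedPrepartition (hkBox a b h),
      π.IsSubordinate r → π.IsHenstock → |riemannError f π| ≤ ε / 2 := by
    intro π h1 h2
    exact BoxIntegral.Integrable.dist_integralSum_sum_integral_le_of_memBaseSet hf hε2
      (c := 0) ⟨h1, fun _ => h2, fun h => (Bool.false_ne_true h).elim, fun h => (Bool.false_ne_true h).elim⟩
  -- The two signs bound the error from above and from below. As both majorants are monotone, their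
  -- sum dominates its absolute value.
  obtain ⟨φ, hφm, hφε, hφ⟩ := exists_monotone_of_abs_riemannError_le (σ := 1) (by simp) hr
  obtain ⟨ψ, hψm, hψε, hψ⟩ := exists_monotone_of_abs_riemannError_le (σ := -1) (by simp) hr
  refine ⟨fun t => r (fun _ => t), fun t => (r _).2, fun x => φ x + ψ x,
    (hφm.add hψm).monotoneOn _, by simp only; linarith, ?_⟩
  intro u t v hau hut htv hvb hvu
  rcases (hut.trans htv).eq_or_lt with rfl | huv
  · simp
  have key : (if hx : a < v then hkIntegral f a v hx else 0) -
      (if hx : a < u then hkIntegral f a u hx else 0) = hkIntegral f u v huv := by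
    rw [dif_pos (hau.trans_lt huv)]
    split_ifs with hu
    · rw [← hf.hkIntegral_add hu huv hvb]; ring
    · obtain rfl : a = u := le_antisymm hau (not_lt.1 hu)
      rw [sub_zero]
  have h1 := hφ u t v hau hut htv hvb hvu huv
  have h2 := hψ u t v hau hut htv hvb hvu huv
  have h3 : φ u ≤ φ v := hφm huv.le
  have h4 : ψ u ≤ ψ v := hψm huv.le
  rw [key, abs_le]
  constructor <;> linarith

/-! ### Calculus of primitives: gluing, differentiable functions, integration by parts, continuity.
-/

theorem IsHKPrimitive.mono {f F : ℝ → ℝ} {a b a' b' : ℝ} (hF : IsHKPrimitive f F a b)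
    (ha : a ≤ a') (hab : a' ≤ b') (hb : b' ≤ b) : IsHKPrimitive f F a' b' := by
  intro ε hε
  obtain ⟨δ, hδ, φ, hφ, hφε, H⟩ := hF ε hε
  refine ⟨δ, hδ, φ, hφ.mono (Icc_subset_Icc ha hb), ?_, fun u t v hu hut htv hv =>
    H u t v (ha.trans hu) hut htv (hv.trans hb)⟩
  have h1 := hφ ⟨le_rfl, ha.trans (hab.trans hb)⟩ ⟨ha, hab.trans hb⟩ ha
  have h2 := hφ ⟨ha.trans hab, hb⟩ ⟨ha.trans (hab.trans hb), le_rfl⟩ hb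
  linarith

/-- A primitive of a function with period `p`, translated by `p` and shifted by a constant. -/
theorem IsHKPrimitive.translate {f F G : ℝ → ℝ} {a b p c : ℝ} (hF : IsHKPrimitive f F a b)
    (hf : Function.Periodic f p) (hG : ∀ x ∈ Icc (a + p) (b + p), G x = F (x - p) + c) :
    IsHKPrimitive f G (a + p) (b + p) := by
  intro ε hε
  obtain ⟨δ, hδ, φ, hφ, hφε, H⟩ := hF ε hε
  refine ⟨fun t => δ (t - p), fun t => hδ _, fun x => φ (x - p), ?_, by simpa using hφε, ?_⟩
  · intro x hx y hy hxy
    exact hφ ⟨by linarith [hx.1], by linarith [hx.2]⟩ ⟨by linarith [hy.1], by linarith [hy.2]⟩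
      (by linarith)
  · intro u t v hu hut htv hv hvu
    rw [hG u ⟨hu, by linarith⟩, hG v ⟨by linarith, hv⟩, ← hf.sub_eq t]
    have := H (u - p) (t - p) (v - p) (by linarith) (by linarith) (by linarith) (by linarith)
      (by linarith)
    convert this using 2
    ring

theorem IsHKPrimitive.glue {f F : ℝ → ℝ} {a b c : ℝ} (h₁ : IsHKPrimitive f F a b)
    (h₂ : IsHKPrimitive f F b c) (hab : a ≤ b) (hbc : b ≤ c) : IsHKPrimitive f F a c := by
  intro ε hε
  obtain ⟨δ, hδ, φ, hφ, hφε, H⟩ := h₁ (ε / 2) (half_pos hε)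
  obtain ⟨δ', hδ', ψ, hψ, hψε, H'⟩ := h₂ (ε / 2) (half_pos hε)
  set χ : ℝ → ℝ := fun x => φ (min x b) + ψ (max x b) with hχ
  have χ1 : ∀ x ≤ b, χ x = φ x + ψ b := fun x hx => by simp [hχ, hx]
  have χ2 : ∀ x, b ≤ x → χ x = φ b + ψ x := fun x hx => by simp [hχ, hx]
  -- Half the distance to `b` keeps an interval with tag `t ≠ b` on one side of `b`. An interval
  -- tagged at `b` is cut there into two intervals with the same tag.
  refine ⟨fun t => if t < b then min (δ t) ((b - t) / 2) else if b < t then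
    min (δ' t) ((t - b) / 2) else min (δ t) (δ' t), ?_, χ, ?_, ?_, ?_⟩
  · intro t
    dsimp only
    split_ifs with h1 h2
    · exact lt_min (hδ t) (by linarith)
    · exact lt_min (hδ' t) (by linarith)
    · exact lt_min (hδ t) (hδ' t)
  · intro x hx y hy hxy
    refine add_le_add (hφ ⟨le_min hx.1 hab, min_le_right _ _⟩ ⟨le_min hy.1 hab, min_le_right _ _⟩
      (min_le_min_right _ hxy)) (hψ ⟨le_max_right _ _, max_le hx.2 hbc⟩
      ⟨le_max_right _ _, max_le hy.2 hbc⟩ (max_le_max_right _ hxy))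
  · rw [χ1 a hab, χ2 c hbc]
    linarith
  · intro u t v hu hut htv hv hvu
    dsimp only at hvu
    split_ifs at hvu with h1 h2
    · have h3 := hvu.trans (min_le_left _ _)
      have h4 := hvu.trans (min_le_right _ _)
      have hvb : v ≤ b := by linarith
      rw [χ1 u (by linarith), χ1 v hvb]
      linarith [H u t v hu hut htv hvb h3]
    · have h3 := hvu.trans (min_le_left _ _)
      have h4 := hvu.trans (min_le_right _ _)
      have hub : b ≤ u := by linarith
      rw [χ2 u hub, χ2 v (by linarith)]
      linarith [H' u t v hub hut htv hv h3]
    · obtain rfl : t = b := le_antisymm (not_lt.1 h2) (not_lt.1 h1)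
      have h3 := hvu.trans (min_le_left _ _)
      have h4 := hvu.trans (min_le_right _ _)
      have e1 := H u t t hu hut le_rfl le_rfl (by linarith)
      have e2 := H' t t v le_rfl le_rfl htv hv (by linarith)
      rw [χ1 u hut, χ2 v htv]
      rw [abs_le] at e1 e2 ⊢
      constructor <;> linarith

theorem IsHKPrimitive.sub {f F g G : ℝ → ℝ} {a b : ℝ} (hF : IsHKPrimitive f F a b)
    (hG : IsHKPrimitive g G a b) : IsHKPrimitive (f - g) (F - G) a b := by
  intro ε hε
  obtain ⟨δ, hδ, φ, hφ, hφε, H⟩ := hF (ε / 2) (half_pos hε)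
  obtain ⟨δ', hδ', ψ, hψ, hψε, H'⟩ := hG (ε / 2) (half_pos hε)
  refine ⟨fun t => min (δ t) (δ' t), fun t => lt_min (hδ t) (hδ' t), fun x => φ x + ψ x,
    hφ.add hψ, by simp only; linarith, ?_⟩
  intro u t v hu hut htv hv hvu
  have e1 := H u t v hu hut htv hv (hvu.trans (min_le_left _ _))
  have e2 := H' u t v hu hut htv hv (hvu.trans (min_le_right _ _))
  simp only [Pi.sub_apply]
  rw [abs_le] at e1 e2 ⊢
  constructor <;> linarith

/-- The straddle lemma. -/
theorem HasDerivAt.straddle {Q : ℝ → ℝ} {q t : ℝ} (h : HasDerivAt Q q t) {ε : ℝ} (hε : 0 < ε) :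
    ∃ δ > 0, ∀ u v, u ≤ t → t ≤ v → v - u ≤ δ →
      |q * (v - u) - (Q v - Q u)| ≤ ε * (v - u) := by
  have h1 := (hasDerivAt_iff_isLittleO.1 h).def hε
  obtain ⟨δ, hδ, H⟩ := Metric.eventually_nhds_iff.1 h1
  refine ⟨δ / 2, half_pos hδ, fun u v hut htv hvu => ?_⟩
  have e1 := @H u (by rw [Real.dist_eq, abs_lt]; constructor <;> linarith)
  have e2 := @H v (by rw [Real.dist_eq, abs_lt]; constructor <;> linarith)
  simp only [Real.norm_eq_abs, smul_eq_mul] at e1 e2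
  rw [abs_of_nonpos (a := u - t) (by linarith)] at e1
  rw [abs_of_nonneg (a := v - t) (by linarith)] at e2
  rw [abs_le] at e1 e2 ⊢
  constructor <;> nlinarith

theorem isHKPrimitive_of_hasDerivAt {f F : ℝ → ℝ} (h : ∀ t, HasDerivAt F (f t) t) {a b : ℝ}
    (hab : a < b) : IsHKPrimitive f F a b := by
  intro ε hε
  have hpos : 0 < ε / (b - a) := div_pos hε (sub_pos.2 hab)
  choose δ hδ H using fun t => (h t).straddle hpos
  refine ⟨δ, hδ, fun x => ε / (b - a) * x, ?_, ?_, ?_⟩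
  · exact (monotone_id.const_mul hpos.le).monotoneOn _
  · rw [← mul_sub, div_mul_cancel₀ _ (sub_pos.2 hab).ne']
  · intro u t v _ hut htv _ hvu
    rw [← mul_sub]
    exact H t u v hut htv hvu

/-- Integration by parts: a primitive of `f g` is `F g - K`, where `K` is a primitive of `F g'`. -/
theorem IsHKPrimitive.mul {f F g g' K : ℝ → ℝ} {a b : ℝ} (hF : IsHKPrimitive f F a b) (hab : a < b)
    (hFc : Continuous F) (hg : ∀ t, HasDerivAt g (g' t) t)
    (hK : ∀ t, HasDerivAt K (F t * g' t) t) :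
    IsHKPrimitive (fun x => f x * g x) (fun x => F x * g x - K x) a b := by
  intro ε hε
  have hgc : Continuous g := continuous_iff_continuousAt.2 fun t => (hg t).continuousAt
  obtain ⟨M, hM⟩ := isCompact_Icc.exists_bound_of_continuousOn (s := Icc a b) hgc.continuousOn
  have hM0 : 0 ≤ M := (norm_nonneg _).trans (hM a ⟨le_rfl, hab.le⟩)
  obtain ⟨δ, hδ, φ, hφ, hφε, H⟩ := hF (ε / 2 / (M + 1)) (by positivity)
  have hpos : 0 < ε / 2 / (b - a) := div_pos (half_pos hε) (sub_pos.2 hab)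
  -- `F` need not be differentiable at `t`: its continuity suffices because `g x - g t` is `O(x -
  -- t)`. The derivative `F t * g' t` of the product cancels that of `K`. The error for `f g` is
  -- thus `g t` times the error for `f`, plus a straddle error.
  have hQ : ∀ t, HasDerivAt (fun x => F x * (g x - g t) - K x) 0 t := by
    intro t
    have h1 : HasDerivAt (fun x => F x * (g x - g t)) (F t * g' t) t := by
      rw [hasDerivAt_iff_isLittleO]
      have h2 := ((hFc.tendsto t).sub_const (F t))
      rw [sub_self] at h2
      have h3 : (fun x => (F x - F t) * (g x - g t)) =o[𝓝 t] fun x => 1 * (x - t) :=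
        ((Asymptotics.isLittleO_one_iff ℝ).2 h2).mul_isBigO (hg t).isBigO_sub
      have h4 := (hasDerivAt_iff_isLittleO.1 (hg t)).const_mul_left (F t)
      simp only [one_mul] at h3
      refine (h3.add h4).congr_left fun x => ?_
      simp only [smul_eq_mul]
      ring
    have h5 := h1.sub (hK t)
    rw [sub_self] at h5
    exact h5
  choose η hη HQ using fun t => (hQ t).straddle hpos
  refine ⟨fun t => min (δ t) (η t), fun t => lt_min (hδ t) (hη t),
    fun x => (M + 1) * φ x + ε / 2 / (b - a) * x, ?_, ?_, ?_⟩
  · intro x hx y hy hxy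
    have := hφ hx hy hxy
    dsimp only
    gcongr
  · have e1 : ε / 2 / (b - a) * b - ε / 2 / (b - a) * a = ε / 2 := by
      rw [← mul_sub, div_mul_cancel₀ _ (sub_pos.2 hab).ne']
    have e2 : (M + 1) * (φ b - φ a) ≤ ε / 2 := by
      rwa [← le_div_iff₀' (by positivity)]
    dsimp only
    linarith
  · intro u t v hu hut htv hv hvu
    have e1 := H u t v hu hut htv hv (hvu.trans (min_le_left _ _))
    have e2 := HQ t u v hut htv (hvu.trans (min_le_right _ _))
    have e3 : |g t| ≤ M + 1 := (hM t ⟨hu.trans hut, htv.trans hv⟩).trans (by linarith)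
    have e4 : |g t * (f t * (v - u) - (F v - F u))| ≤ (M + 1) * (φ v - φ u) := by
      rw [abs_mul]
      exact mul_le_mul e3 e1 (abs_nonneg _) (by linarith)
    calc |f t * g t * (v - u) - (F v * g v - K v - (F u * g u - K u))|
        = |g t * (f t * (v - u) - (F v - F u)) + (0 * (v - u) -
          ((F v * (g v - g t) - K v) - (F u * (g u - g t) - K u)))| := by congr 1; ring
      _ ≤ (M + 1) * (φ v - φ u) + ε / 2 / (b - a) * (v - u) := (abs_add_le _ _).trans (add_le_add e4 e2)
      _ = _ := by ring

theorem IsHKPrimitive.continuousAt {f F : ℝ → ℝ} {a b t : ℝ} (hF : IsHKPrimitive f F a b)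
    (ht : t ∈ Ioo a b) : ContinuousAt F t := by
  rw [Metric.continuousAt_iff]
  intro ε hε
  obtain ⟨δ, hδ, φ, hφ, hφε, H⟩ := hF (ε / 2) (half_pos hε)
  have hvar : ∀ u v, a ≤ u → u ≤ v → v ≤ b → φ v - φ u ≤ ε / 2 := by
    intro u v hu huv hv
    have h1 := hφ ⟨le_rfl, by linarith⟩ ⟨hu, by linarith⟩ hu
    have h2 := hφ ⟨by linarith, hv⟩ ⟨by linarith, le_rfl⟩ hv
    linarith
  -- An increment of `F` from `t` is at most `|f t| |x - t|` plus an increment of `φ`. These are at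
  -- most `ε / 4` and `ε / 2`.
  set k := ε / 4 / (|f t| + 1)
  have hk : 0 < k := by positivity
  have hkf : |f t| * k ≤ ε / 4 := by
    have : (|f t| + 1) * k = ε / 4 := mul_div_cancel₀ _ (by positivity)
    nlinarith
  refine ⟨min (min (δ t) k) (min (t - a) (b - t)), lt_min (lt_min (hδ t) hk)
    (lt_min (by linarith [ht.1]) (by linarith [ht.2])), fun {x} hx => ?_⟩
  rw [Real.dist_eq, lt_min_iff, lt_min_iff, lt_min_iff] at hx
  obtain ⟨⟨h1, h2⟩, h3, h4⟩ := hx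
  have hfx : |f t * (x - t)| ≤ ε / 4 := by
    rw [abs_mul]
    exact (mul_le_mul_of_nonneg_left h2.le (abs_nonneg _)).trans hkf
  rw [Real.dist_eq]
  rw [abs_lt] at h1 h3 h4
  rw [abs_le] at hfx
  rcases le_total t x with htx | hxt
  · have e1 := H t t x ht.1.le le_rfl htx (by linarith) (by linarith)
    have e2 := hvar t x ht.1.le htx (by linarith)
    rw [abs_le] at e1
    rw [abs_lt]
    constructor <;> linarith
  · have e1 := H x t t (by linarith) hxt le_rfl ht.2.le (by linarith)
    have e2 := hvar x t (by linarith) hxt ht.2.le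
    rw [abs_le] at e1
    rw [abs_lt]
    constructor <;> linarith

/-! ### The Alexiewicz norm in terms of primitives. -/

theorem hkIntegrable_of_alexiewiczNorm_lt_top {f : ℝ → ℝ} (hf : alexiewiczNorm f < ∞) {a b : ℝ}
    (h : a < b) (hab : b - a ≤ 2 * Real.pi) :
    HKIntegrable f a b h ∧ ENNReal.ofReal |hkIntegral f a b h| ≤ alexiewiczNorm f := by
  classical
  have hle : (if HKIntegrable f a b h then ENNReal.ofReal |hkIntegral f a b h| else ∞) ≤
      alexiewiczNorm f := by
    unfold alexiewiczNorm
    refine le_iSup_of_le a (le_iSup_of_le b (le_iSup_of_le h (le_iSup_of_le hab ?_)))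
    split_ifs <;> exact le_rfl
  split_ifs at hle with hi
  · exact ⟨hi, hle⟩
  · exact absurd (hle.trans_lt hf) (lt_irrefl _)

theorem alexiewiczNorm_le_of_primitive {f F : ℝ → ℝ} {N : ℝ≥0∞}
    (hF : ∀ a b, a < b → b - a ≤ 2 * Real.pi → IsHKPrimitive f F a b)
    (hN : ∀ a b, a < b → b - a ≤ 2 * Real.pi → ENNReal.ofReal |F b - F a| ≤ N) :
    alexiewiczNorm f ≤ N := by
  unfold alexiewiczNorm
  refine iSup_le fun a => iSup_le fun b => iSup_le fun h => iSup_le fun hab => ?_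
  rw [if_pos ((hF a b h hab).integrable h), (hF a b h hab).hkIntegral_eq h]
  exact hN a b h hab

theorem le_alexiewiczNorm_of_primitive {f F : ℝ → ℝ} {a b : ℝ} (hab : a < b)
    (hle : b - a ≤ 2 * Real.pi) (hF : IsHKPrimitive f F a b) :
    ENNReal.ofReal |F b - F a| ≤ alexiewiczNorm f := by
  unfold alexiewiczNorm
  refine le_iSup_of_le a (le_iSup_of_le b (le_iSup_of_le hab (le_iSup_of_le hle ?_)))
  rw [if_pos (hF.integrable hab), hF.hkIntegral_eq hab]

/-- A function of the space `HKCircle` has a continuous, quasi-periodic global primitive. -/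
theorem exists_global_primitive {f : ℝ → ℝ} (hf : f ∈ HKCircle) :
    ∃ (F : ℝ → ℝ) (c : ℝ), Continuous F ∧ (∀ x, F (x + 2 * Real.pi) = F x + c) ∧
      ∀ a b, a < b → b - a ≤ 2 * Real.pi → IsHKPrimitive f F a b := by
  set T := 2 * Real.pi with hT
  have hT0 : 0 < T := Real.two_pi_pos
  obtain ⟨F₀, hF₀⟩ := (hkIntegrable_of_alexiewiczNorm_lt_top hf.2 hT0
    (by rw [sub_zero])).1.exists_isHKPrimitive
  set c := F₀ T - F₀ 0 with hc
  set F : ℝ → ℝ := fun x => F₀ (x - ⌊x / T⌋ * T) + ⌊x / T⌋ * c with hFdef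
  -- The formula holds on closed cells: at a right endpoint the floor jumps to `n + 1`, and the two
  -- values agree by the choice of `c`.
  have hFn : ∀ (n : ℤ), ∀ x ∈ Icc (0 + n * T) (T + n * T), F x = F₀ (x - n * T) + n * c := by
    intro n x hx
    rcases hx.2.eq_or_lt with h | h
    · have hfl : ⌊x / T⌋ = n + 1 := by
        rw [h, ← one_add_mul, mul_div_assoc, div_self hT0.ne', mul_one, add_comm]
        exact_mod_cast Int.floor_intCast (n + 1)
      simp only [hFdef, hfl]
      push_cast
      rw [h]
      rw [show T + n * T - (n + 1) * T = 0 by ring, show T + n * T - n * T = T by ring, hc]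
      ring
    · have hfl : ⌊x / T⌋ = n := by
        rw [Int.floor_eq_iff, le_div_iff₀ hT0, div_lt_iff₀ hT0]
        constructor <;> linarith [hx.1]
      simp only [hFdef, hfl]
  have hprim : ∀ n : ℤ, IsHKPrimitive f F (0 + n * T) (T + n * T) := fun n =>
    hF₀.translate (hf.1.int_mul n) (hFn n)
  have hall : ∀ a b, a < b → b - a ≤ T → IsHKPrimitive f F a b := by
    intro a b hab hle
    set n := ⌊a / T⌋
    have h1 : n * T ≤ a := (le_div_iff₀ hT0).1 (Int.floor_le _)
    have h2 : a < (n + 1) * T := (div_lt_iff₀ hT0).1 (Int.lt_floor_add_one _)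
    -- An interval of length at most one period that starts in cell `n` lies within cells `n` and `n
    -- + 1`.
    have hg := (hprim n).glue (b := T + n * T) (c := T + (n + 1 : ℤ) * T)
      (by convert hprim (n + 1) using 1; push_cast; ring) (by linarith)
      (by push_cast; linarith)
    refine hg.mono (by linarith) hab.le ?_
    push_cast
    linarith
  refine ⟨F, c, continuous_iff_continuousAt.2 fun x => ?_, fun x => ?_, hall⟩
  · exact (hall (x - T / 2) (x + T / 2) (by linarith) (by linarith)).continuousAt
      ⟨by linarith, by linarith⟩
  · have hfl : ⌊(x + T) / T⌋ = ⌊x / T⌋ + 1 := by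
      rw [add_div, div_self hT0.ne', Int.floor_add_one]
    simp only [hFdef, hfl]
    push_cast
    rw [show x + T - (⌊x / T⌋ + 1) * T = x - ⌊x / T⌋ * T by ring]
    ring

/-! ### Estimates for the Poisson kernel. -/

theorem poissonPhi_denom_pos {r : ℝ} (hr : r ∈ Ico (0 : ℝ) 1) (θ : ℝ) :
    0 < 1 - 2 * r * Real.cos θ + r ^ 2 := by
  nlinarith [hr.1, hr.2, Real.cos_le_one θ, mul_nonneg hr.1 (sub_nonneg.2 (Real.cos_le_one θ)),
    pow_pos (sub_pos.2 hr.2) 2]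

theorem poissonPhi_nonneg {r : ℝ} (hr : r ∈ Ico (0 : ℝ) 1) (θ : ℝ) : 0 ≤ poissonPhi r θ := by
  have h1 := poissonPhi_denom_pos hr θ
  have h2 : 0 ≤ 1 - r ^ 2 := by nlinarith [hr.1, hr.2]
  unfold poissonPhi
  have := Real.pi_pos
  positivity

theorem poissonPhi_periodic (r : ℝ) : Function.Periodic (poissonPhi r) (2 * Real.pi) := by
  intro θ
  simp [poissonPhi]

theorem contDiff_poissonPhi {r : ℝ} (hr : r ∈ Ico (0 : ℝ) 1) : ContDiff ℝ 1 (poissonPhi r) := by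
  unfold poissonPhi
  refine contDiff_const.div (by fun_prop) fun θ => ?_
  exact mul_ne_zero Real.two_pi_pos.ne' (poissonPhi_denom_pos hr θ).ne'

theorem poissonPhi_le {r : ℝ} (hr : r ∈ Ico (0 : ℝ) 1) (θ : ℝ) :
    poissonPhi r θ ≤ (1 + r) / (2 * Real.pi * (1 - r)) := by
  have h1 := poissonPhi_denom_pos hr θ
  have h3 : 0 < 1 - r := sub_pos.2 hr.2
  have hpi := Real.pi_pos
  unfold poissonPhi
  rw [div_le_div_iff₀ (by positivity) (by positivity)]
  have h4 : (1 - r) ^ 2 ≤ 1 - 2 * r * Real.cos θ + r ^ 2 := by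
    nlinarith [mul_nonneg hr.1 (sub_nonneg.2 (Real.cos_le_one θ))]
  have h5 : 0 ≤ (1 + r) * (2 * Real.pi) := by
    have := hr.1
    positivity
  nlinarith [mul_le_mul_of_nonneg_left h4 h5]

/-- The factor `1 - cos θ` cancels the peak of the kernel, since `2r (1 - cos θ)` and the
denominator `1 - 2r cos θ + r²` differ by `(1 - r)²`. The bound vanishes as `r → 1` and drives the
convergence in (b). -/
theorem one_sub_cos_mul_poissonPhi_le {r : ℝ} (hr : r ∈ Ioo (0 : ℝ) 1) (θ : ℝ) :
    (1 - Real.cos θ) * poissonPhi r θ ≤ (1 - r ^ 2) / (4 * Real.pi * r) := by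
  have h1 := poissonPhi_denom_pos ⟨hr.1.le, hr.2⟩ θ
  have h0 := hr.1
  have hpi := Real.pi_pos
  unfold poissonPhi
  rw [mul_div_assoc', div_le_div_iff₀ (by positivity) (by positivity)]
  have h2 : 0 ≤ (1 - r ^ 2) * (2 * Real.pi) := by
    have : 0 ≤ 1 - r ^ 2 := by nlinarith [hr.1, hr.2]
    positivity
  have h3 : (1 - Real.cos θ) * (2 * r) ≤ 1 - 2 * r * Real.cos θ + r ^ 2 := by
    nlinarith [sq_nonneg (1 - r)]
  nlinarith [mul_le_mul_of_nonneg_left h3 h2]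

/-- This is the Poisson formula for the constant function `1` on the unit disc, evaluated at the
point `r`. -/
theorem integral_poissonPhi {r : ℝ} (hr : r ∈ Ico (0 : ℝ) 1) :
    ∫ φ in (-Real.pi)..Real.pi, poissonPhi r φ = 1 := by
  have hd : DiffContOnCl ℂ (fun _ : ℂ => (1 : ℂ)) (Metric.ball 0 1) := diffContOnCl_const
  have hw : (r : ℂ) ∈ Metric.ball (0 : ℂ) 1 := by
    simp [abs_of_nonneg hr.1, hr.2]
  have key := hd.circleAverage_poissonKernel_smul hw
  rw [Real.circleAverage] at key
  have hk : ∀ θ : ℝ, (poissonKernel 0 (r : ℂ) • fun _ : ℂ => (1 : ℂ)) (circleMap 0 1 θ) =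
      ((2 * Real.pi * poissonPhi r θ : ℝ) : ℂ) := by
    intro θ
    have hn : ‖circleMap 0 1 θ - (r : ℂ)‖ ^ 2 = 1 - 2 * r * Real.cos θ + r ^ 2 := by
      rw [← Complex.normSq_eq_norm_sq, Complex.normSq_apply]
      simp [circleMap, Complex.exp_ofReal_mul_I_re, Complex.exp_ofReal_mul_I_im]
      nlinarith [Real.sin_sq_add_cos_sq θ]
    have hpi := Real.pi_pos.ne'
    have hD := (poissonPhi_denom_pos hr θ).ne'
    simp only [Pi.smul_apply', poissonKernel_def, sub_zero, hn, poissonPhi]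
    simp only [norm_circleMap_zero, Complex.norm_real, Real.norm_eq_abs, sq_abs, abs_one, one_pow,
      Complex.real_smul, mul_one]
    congr 1
    field_simp
  simp only [hk] at key
  rw [intervalIntegral.integral_ofReal, intervalIntegral.integral_const_mul] at key
  have h2 := (poissonPhi_periodic r).intervalIntegral_add_eq (-Real.pi) 0
  rw [show -Real.pi + 2 * Real.pi = Real.pi by ring, zero_add] at h2
  rw [h2]
  have hpi := Real.pi_pos.ne'
  rw [Complex.real_smul, ← Complex.ofReal_mul] at key
  have key := Complex.ofReal_eq_one.1 key
  field_simp at key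
  exact key

/-! ### The Poisson integral as the derivative of a convolution. -/

/-- The convolution of `F` with the Poisson kernel, a primitive of the Poisson integral of `F'`. -/
noncomputable def poissonMean (F : ℝ → ℝ) (r θ : ℝ) : ℝ :=
  ∫ φ in (-Real.pi)..Real.pi, F (θ + φ) * poissonPhi r φ

theorem Continuous.intervalIntegrable_mul_poissonPhi {F : ℝ → ℝ} (hF : Continuous F) {r : ℝ}
    (hr : r ∈ Ico (0 : ℝ) 1) (a b : ℝ) :
    IntervalIntegrable (fun φ => F φ * poissonPhi r φ) MeasureTheory.volume a b :=
  (hF.mul (contDiff_poissonPhi hr).continuous).intervalIntegrable a b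

theorem poissonMean_sub_eq {F : ℝ → ℝ} (hF : Continuous F) {r : ℝ} (hr : r ∈ Ico (0 : ℝ) 1)
    (a b : ℝ) : poissonMean F r b - poissonMean F r a =
      ∫ φ in (-Real.pi)..Real.pi, (F (b + φ) - F (a + φ)) * poissonPhi r φ := by
  rw [poissonMean, poissonMean, ← intervalIntegral.integral_sub]
  · exact intervalIntegral.integral_congr fun φ _ => (sub_mul _ _ _).symm
  · exact Continuous.intervalIntegrable_mul_poissonPhi (by fun_prop) hr _ _
  · exact Continuous.intervalIntegrable_mul_poissonPhi (by fun_prop) hr _ _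

/-- Averages against the Poisson kernel preserve bounds. -/
theorem abs_integral_mul_poissonPhi_le {G : ℝ → ℝ} (hG : Continuous G) {r : ℝ}
    (hr : r ∈ Ico (0 : ℝ) 1) {N : ℝ} (hN : ∀ φ, |G φ| ≤ N) :
    |∫ φ in (-Real.pi)..Real.pi, G φ * poissonPhi r φ| ≤ N := by
  have hle : -Real.pi ≤ Real.pi := neg_pi_lt_pi.le
  refine (intervalIntegral.abs_integral_le_integral_abs hle).trans ?_
  calc ∫ φ in (-Real.pi)..Real.pi, |G φ * poissonPhi r φ|
      ≤ ∫ φ in (-Real.pi)..Real.pi, N * poissonPhi r φ := by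
        refine intervalIntegral.integral_mono_on hle ?_ ?_ fun φ _ => ?_
        · exact (hG.mul (contDiff_poissonPhi hr).continuous).abs.intervalIntegrable _ _
        · exact Continuous.intervalIntegrable_mul_poissonPhi continuous_const hr _ _
        · rw [abs_mul, abs_of_nonneg (poissonPhi_nonneg hr φ)]
          exact mul_le_mul_of_nonneg_right (hN φ) (poissonPhi_nonneg hr φ)
    _ = N := by rw [intervalIntegral.integral_const_mul, integral_poissonPhi hr, mul_one]

theorem hasDerivAt_integral_mul_comp_sub {P Φ : ℝ → ℝ} (hP : Continuous P) (hΦ : ContDiff ℝ 1 Φ)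
    (a b θ : ℝ) :
    HasDerivAt (fun x => ∫ s in a..b, P s * Φ (s - x)) (∫ s in a..b, P s * -deriv Φ (s - θ)) θ := by
  have hd := hΦ.continuous_deriv le_rfl
  have hΦc := hΦ.continuous
  -- This compact interval contains `s - x` for all `s` between `a` and `b` and all `x` within
  -- distance `1` of `θ`.
  obtain ⟨B, hB⟩ := (isCompact_Icc (a := min a b - θ - 1)
    (b := max a b - θ + 1)).exists_bound_of_continuousOn hd.continuousOn
  refine (intervalIntegral.hasDerivAt_integral_of_dominated_loc_of_deriv_le
    (F := fun x s => P s * Φ (s - x)) (F' := fun x s => P s * -deriv Φ (s - x))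
    (bound := fun s => |P s| * B) (Metric.ball_mem_nhds θ one_pos) ?_ ?_ ?_ ?_ ?_ ?_).2
  · exact Eventually.of_forall fun x => Continuous.aestronglyMeasurable (by fun_prop)
  · exact Continuous.intervalIntegrable (by fun_prop) _ _
  · exact Continuous.aestronglyMeasurable (by fun_prop)
  · refine Eventually.of_forall fun t ht x hx => ?_
    rw [norm_mul, norm_neg]
    refine mul_le_mul_of_nonneg_left (hB _ ?_) (abs_nonneg _)
    rw [Metric.mem_ball, Real.dist_eq, abs_lt] at hx
    have h1 : min a b < t := ht.1
    have h2 : t ≤ max a b := ht.2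
    constructor <;> linarith
  · exact Continuous.intervalIntegrable (by fun_prop) _ _
  · refine Eventually.of_forall fun t _ x _ => HasDerivAt.const_mul _ ?_
    have h1 := (hΦ.differentiable one_ne_zero (t - x)).hasDerivAt
    exact HasDerivAt.comp_const_sub t x h1

theorem integral_poissonPhi_sub {r : ℝ} (hr : r ∈ Ico (0 : ℝ) 1) (θ : ℝ) :
    ∫ φ in (-Real.pi)..Real.pi, poissonPhi r (φ - θ) = 1 := by
  rw [intervalIntegral.integral_comp_sub_right (fun x => poissonPhi r x), ← integral_poissonPhi hr]
  have := (poissonPhi_periodic r).intervalIntegral_add_eq (-Real.pi - θ) (-Real.pi)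
  rw [show -Real.pi - θ + 2 * Real.pi = Real.pi - θ by ring,
    show -Real.pi + 2 * Real.pi = Real.pi by ring] at this
  exact this

/-- Existence of the Poisson integral, and its value as a derivative. -/
theorem poissonInt_of_primitive {f F : ℝ → ℝ} {c : ℝ} (hFc : Continuous F)
    (hper : ∀ x, F (x + 2 * Real.pi) = F x + c) (hF : IsHKPrimitive f F (-Real.pi) Real.pi)
    {r : ℝ} (hr : r ∈ Ico (0 : ℝ) 1) (θ : ℝ) :
    HKIntegrable (fun φ => f φ * poissonPhi r (φ - θ)) (-Real.pi) Real.pi neg_pi_lt_pi ∧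
      HasDerivAt (poissonMean F r) (poissonInt f r θ) θ := by
  have hΦ := contDiff_poissonPhi hr
  have hΦc := hΦ.continuous
  have hd := hΦ.continuous_deriv le_rfl
  have hpi := Real.pi_pos
  set g : ℝ → ℝ := fun φ => poissonPhi r (φ - θ) with hg
  set g' : ℝ → ℝ := fun φ => deriv (poissonPhi r) (φ - θ) with hg'
  have hgd : ∀ t, HasDerivAt g (g' t) t := fun t => by
    have h1 := (hΦ.differentiable one_ne_zero (t - θ)).hasDerivAt
    exact HasDerivAt.comp_sub_const t θ h1
  have hgc : Continuous g := by fun_prop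
  have hgc' : Continuous g' := by fun_prop
  have hFg : Continuous fun t => F t * g' t := hFc.mul hgc'
  have hprim := hF.mul neg_pi_lt_pi hFc hgd (K := fun x => ∫ t in (-Real.pi)..x, F t * g' t)
    fun t => intervalIntegral.integral_hasDerivAt_right (hFg.intervalIntegrable _ _)
      hFg.aestronglyMeasurable.stronglyMeasurableAtFilter hFg.continuousAt
  refine ⟨hprim.integrable neg_pi_lt_pi, ?_⟩
  have hval : poissonInt f r θ = _ := hprim.hkIntegral_eq neg_pi_lt_pi
  -- Removing the linear part `k x` leaves a periodic `P`, for which the variable can be moved into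
  -- the kernel and differentiated there. The linear part contributes the constant `k` to `u_r`.
  set k := c / (2 * Real.pi) with hk
  have hck : c = 2 * Real.pi * k := by rw [hk]; field_simp
  set P : ℝ → ℝ := fun x => F x - k * x with hP
  have hPc : Continuous P := by fun_prop
  have hPper : Function.Periodic P (2 * Real.pi) := fun x => by
    simp only [hP, hper, hck]
    ring
  have hgpi : g (-Real.pi) = g Real.pi := by
    have := poissonPhi_periodic r (-Real.pi - θ)
    simp only [hg]
    rw [← this]
    congr 1
    ring
  have hFpi : F Real.pi = F (-Real.pi) + c := by
    rw [← hper]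
    congr 1
    ring
  have hparts : ∫ s in (-Real.pi)..Real.pi, s * g' s = 2 * Real.pi * g Real.pi - 1 := by
    rw [intervalIntegral.integral_mul_deriv_eq_deriv_mul (u := fun s => s) (u' := fun _ => 1)
      (v := g) (fun x _ => hasDerivAt_id x) (fun x _ => hgd x)
      (continuous_const.intervalIntegrable _ _) (hgc'.intervalIntegrable _ _), hgpi]
    simp only [one_mul]
    rw [show ∫ x in (-Real.pi)..Real.pi, g x = 1 from integral_poissonPhi_sub hr θ]
    ring
  have hsplit : ∫ s in (-Real.pi)..Real.pi, F s * g' s =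
      (∫ s in (-Real.pi)..Real.pi, P s * g' s) + k * (2 * Real.pi * g Real.pi - 1) := by
    rw [← hparts, ← intervalIntegral.integral_const_mul, ← intervalIntegral.integral_add]
    · refine intervalIntegral.integral_congr fun s _ => ?_
      simp only [hP]
      ring
    · exact Continuous.intervalIntegrable (by fun_prop) _ _
    · exact Continuous.intervalIntegrable (by fun_prop) _ _
  have hval' : poissonInt f r θ = (∫ s in (-Real.pi)..Real.pi, P s * -g' s) + k := by
    rw [hval, hgpi, hFpi, intervalIntegral.integral_same, hsplit]
    simp only [mul_neg, intervalIntegral.integral_neg]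
    rw [hck]
    ring
  have hU : poissonMean F r = fun x => (∫ s in (-Real.pi)..Real.pi, P s * poissonPhi r (s - x)) +
      (k * x + k * ∫ φ in (-Real.pi)..Real.pi, φ * poissonPhi r φ) := by
    funext x
    have h1 : ∫ s in (-Real.pi)..Real.pi, P s * poissonPhi r (s - x) =
        ∫ φ in (-Real.pi)..Real.pi, P (x + φ) * poissonPhi r φ := by
      have hper' : Function.Periodic (fun s => P s * poissonPhi r (s - x)) (2 * Real.pi) := by
        intro s
        simp only [hPper s, show s + 2 * Real.pi - x = s - x + 2 * Real.pi by ring,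
          poissonPhi_periodic r (s - x)]
      have h2 := hper'.intervalIntegral_add_eq (-Real.pi) (x + -Real.pi)
      rw [show -Real.pi + 2 * Real.pi = Real.pi by ring,
        show x + -Real.pi + 2 * Real.pi = x + Real.pi by ring] at h2
      rw [h2, ← intervalIntegral.integral_comp_add_left (fun s => P s * poissonPhi r (s - x))]
      simp only [add_sub_cancel_left]
    rw [h1]
    have h3 : k * x = ∫ φ in (-Real.pi)..Real.pi, k * x * poissonPhi r φ := by
      rw [intervalIntegral.integral_const_mul, integral_poissonPhi hr, mul_one]
    rw [h3, ← intervalIntegral.integral_const_mul, ← intervalIntegral.integral_add,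
      ← intervalIntegral.integral_add, poissonMean]
    · refine intervalIntegral.integral_congr fun s _ => ?_
      simp only [hP]
      ring
    all_goals exact Continuous.intervalIntegrable (by fun_prop) _ _
  rw [hU, hval']
  refine (hasDerivAt_integral_mul_comp_sub hPc hΦ _ _ θ).add ?_
  simpa using ((hasDerivAt_id θ).const_mul k).add_const
    (k * ∫ φ in (-Real.pi)..Real.pi, φ * poissonPhi r φ)

theorem IsHKPrimitive.poissonInt {f F : ℝ → ℝ} {c : ℝ} (hFc : Continuous F)
    (hper : ∀ x, F (x + 2 * Real.pi) = F x + c)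
    (hF : ∀ a b, a < b → b - a ≤ 2 * Real.pi → IsHKPrimitive f F a b)
    {r : ℝ} (hr : r ∈ Ico (0 : ℝ) 1) {a b : ℝ} (hab : a < b) :
    IsHKPrimitive (poissonInt f r) (poissonMean F r) a b :=
  isHKPrimitive_of_hasDerivAt (fun θ => (poissonInt_of_primitive hFc hper
    (hF _ _ neg_pi_lt_pi (by linarith)) hr θ).2) hab

/-! ### Part (a): the norm bound. -/

theorem abs_primitive_sub_le {f F : ℝ → ℝ} (hf : alexiewiczNorm f < ∞)
    (hF : ∀ a b, a < b → b - a ≤ 2 * Real.pi → IsHKPrimitive f F a b) {x y : ℝ}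
    (hxy : |y - x| ≤ 2 * Real.pi) : |F y - F x| ≤ (alexiewiczNorm f).toReal := by
  have key : ∀ a b, a < b → b - a ≤ 2 * Real.pi → |F b - F a| ≤ (alexiewiczNorm f).toReal :=
    fun a b hab hle => (ENNReal.ofReal_le_iff_le_toReal hf.ne).1
      (le_alexiewiczNorm_of_primitive hab hle (hF a b hab hle))
  rcases lt_trichotomy x y with h | rfl | h
  · exact key x y h ((le_abs_self _).trans hxy)
  · simp
  · rw [abs_sub_comm]
    exact key y x h ((le_abs_self _).trans (by rwa [abs_sub_comm]))

theorem alexiewiczNorm_poissonInt_le {f : ℝ → ℝ} (hf : f ∈ HKCircle) {r : ℝ}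
    (hr : r ∈ Ico (0 : ℝ) 1) : alexiewiczNorm (poissonInt f r) ≤ alexiewiczNorm f := by
  obtain ⟨F, c, hFc, hper, hF⟩ := exists_global_primitive hf
  refine alexiewiczNorm_le_of_primitive
    (fun a b hab _ => IsHKPrimitive.poissonInt hFc hper hF hr hab) fun a b hab hle => ?_
  rw [ENNReal.ofReal_le_iff_le_toReal hf.2.ne, poissonMean_sub_eq hFc hr]
  refine abs_integral_mul_poissonPhi_le (by fun_prop) hr fun φ =>
    abs_primitive_sub_le hf.2 hF ?_
  rw [add_sub_add_right_eq_sub, abs_of_pos (sub_pos.2 hab)]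
  exact hle

/-! ### Part (b): convergence in norm. -/

/-- Uniform continuity of a quasi-periodic function, with modulus adapted to the Poisson kernel. -/
theorem exists_abs_sub_le_add_mul_one_sub_cos {F : ℝ → ℝ} {c : ℝ} (hFc : Continuous F)
    (hper : ∀ x, F (x + 2 * Real.pi) = F x + c) {e : ℝ} (he : 0 < e) :
    ∃ C, 0 ≤ C ∧ ∀ x φ, |φ| ≤ Real.pi → |F (x + φ) - F x| ≤ e + C * (1 - Real.cos φ) := by
  have hpi := Real.pi_pos
  have hK := isCompact_Icc (a := -Real.pi) (b := 3 * Real.pi)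
  have huc := hK.uniformContinuousOn_of_continuous hFc.continuousOn
  rw [Metric.uniformContinuousOn_iff] at huc
  obtain ⟨δ, hδ, H⟩ := huc e he
  obtain ⟨M, hM⟩ := hK.exists_bound_of_continuousOn hFc.continuousOn
  have hM0 : 0 ≤ M := (norm_nonneg _).trans (hM 0 ⟨by linarith, by linarith⟩)
  set δ' := min δ Real.pi
  have hδ' : 0 < δ' := lt_min hδ hpi
  have hcos : 0 < 1 - Real.cos δ' := by
    have := Real.cos_lt_cos_of_nonneg_of_le_pi le_rfl (min_le_right δ Real.pi) hδ'
    rw [Real.cos_zero] at this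
    linarith
  -- For `|φ| ≥ δ'` the second term alone is at least `2M`, which bounds the increment. The
  -- increment is periodic in `x`, so `x` can be taken in `[0, 2π)`, and then both points lie in
  -- `[-π, 3π]`.
  refine ⟨2 * M / (1 - Real.cos δ'), by positivity, fun x φ hφ => ?_⟩
  have hp : Function.Periodic (fun x => |F (x + φ) - F x|) (2 * Real.pi) := fun x => by
    simp only [hper, add_right_comm x (2 * Real.pi) φ, add_sub_add_right_eq_sub]
  obtain ⟨y, hy, hxy⟩ := hp.exists_mem_Ico₀ Real.two_pi_pos x
  rw [hxy]
  have hφ' := abs_le.1 hφ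
  have hy1 : y ∈ Icc (-Real.pi) (3 * Real.pi) := ⟨by linarith [hy.1], by linarith [hy.2]⟩
  have hy2 : y + φ ∈ Icc (-Real.pi) (3 * Real.pi) :=
    ⟨by linarith [hy.1, hφ'.1], by linarith [hy.2, hφ'.2]⟩
  rcases lt_or_ge |φ| δ' with h | h
  · have h1 := H _ hy2 _ hy1 (by
      rw [Real.dist_eq, add_sub_cancel_left]
      exact h.trans_le (min_le_left _ _))
    rw [Real.dist_eq] at h1
    have h2 : 0 ≤ 2 * M / (1 - Real.cos δ') * (1 - Real.cos φ) :=
      mul_nonneg (by positivity) (sub_nonneg.2 (Real.cos_le_one _))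
    linarith
  · have h1 : Real.cos φ ≤ Real.cos δ' := by
      rw [← Real.cos_abs φ]
      exact Real.cos_le_cos_of_nonneg_of_le_pi hδ'.le hφ h
    have h2 : 2 * M ≤ 2 * M / (1 - Real.cos δ') * (1 - Real.cos φ) := by
      rw [div_mul_eq_mul_div, le_div_iff₀ hcos]
      gcongr
    have h3 := abs_sub (F (y + φ)) (F y)
    have h4 := hM _ hy1
    have h5 := hM _ hy2
    rw [Real.norm_eq_abs] at h4 h5
    linarith

theorem abs_poissonMean_sub_le {F : ℝ → ℝ} (hFc : Continuous F) {e C : ℝ} (hC : 0 ≤ C)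
    (H : ∀ x φ, |φ| ≤ Real.pi → |F (x + φ) - F x| ≤ e + C * (1 - Real.cos φ))
    {r : ℝ} (hr : r ∈ Ioo (0 : ℝ) 1) (x : ℝ) :
    |poissonMean F r x - F x| ≤ e + C * ((1 - r ^ 2) / (2 * r)) := by
  have hr' : r ∈ Ico (0 : ℝ) 1 := ⟨hr.1.le, hr.2⟩
  have hle : -Real.pi ≤ Real.pi := neg_pi_lt_pi.le
  have hΦc := (contDiff_poissonPhi hr').continuous
  have h1 : poissonMean F r x - F x =
      ∫ φ in (-Real.pi)..Real.pi, (F (x + φ) - F x) * poissonPhi r φ := by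
    have h2 : F x = ∫ φ in (-Real.pi)..Real.pi, F x * poissonPhi r φ := by
      rw [intervalIntegral.integral_const_mul, integral_poissonPhi hr', mul_one]
    conv_lhs => rw [h2]
    rw [poissonMean, ← intervalIntegral.integral_sub]
    · exact intervalIntegral.integral_congr fun φ _ => (sub_mul _ _ _).symm
    · exact Continuous.intervalIntegrable (by fun_prop) _ _
    · exact Continuous.intervalIntegrable (by fun_prop) _ _
  rw [h1]
  refine (intervalIntegral.abs_integral_le_integral_abs hle).trans ?_
  calc ∫ φ in (-Real.pi)..Real.pi, |(F (x + φ) - F x) * poissonPhi r φ|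
      ≤ ∫ φ in (-Real.pi)..Real.pi,
          (e * poissonPhi r φ + C * ((1 - r ^ 2) / (4 * Real.pi * r))) := by
        refine intervalIntegral.integral_mono_on hle ?_ ?_ fun φ hφ => ?_
        · exact Continuous.intervalIntegrable (by fun_prop) _ _
        · exact Continuous.intervalIntegrable (by fun_prop) _ _
        · rw [abs_mul, abs_of_nonneg (poissonPhi_nonneg hr' φ)]
          have h3 := mul_le_mul_of_nonneg_right (H x φ (abs_le.2 hφ)) (poissonPhi_nonneg hr' φ)
          have h4 := mul_le_mul_of_nonneg_left (one_sub_cos_mul_poissonPhi_le hr φ) hC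
          linarith
    _ = e + C * ((1 - r ^ 2) / (2 * r)) := by
        rw [intervalIntegral.integral_add, intervalIntegral.integral_const_mul,
          integral_poissonPhi hr', intervalIntegral.integral_const]
        · have := hr.1.ne'
          have := Real.pi_pos.ne'
          simp only [smul_eq_mul]
          field_simp
          ring
        · exact Continuous.intervalIntegrable (by fun_prop) _ _
        · exact Continuous.intervalIntegrable (by fun_prop) _ _

theorem tendsto_alexiewiczNorm_poissonInt_sub {f : ℝ → ℝ} (hf : f ∈ HKCircle) :
    Tendsto (fun r : ℝ => alexiewiczNorm (poissonInt f r - f)) (𝓝[<] 1) (𝓝 0) := by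
  obtain ⟨F, c, hFc, hper, hF⟩ := exists_global_primitive hf
  rw [ENNReal.tendsto_nhds_zero]
  intro ε hε
  rcases eq_or_ne ε ∞ with rfl | hε'
  · simp
  have he : 0 < ε.toReal := ENNReal.toReal_pos hε.ne' hε'
  -- With `e` and the `C` term each at most `ε / 4`, each endpoint of an interval costs at most `ε /
  -- 2`.
  obtain ⟨C, hC, H⟩ := exists_abs_sub_le_add_mul_one_sub_cos hFc hper
    (e := ε.toReal / 4) (by positivity)
  have hlim : Tendsto (fun r : ℝ => C * ((1 - r ^ 2) / (2 * r))) (𝓝[<] 1) (𝓝 0) := by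
    have h1 : ContinuousAt (fun r : ℝ => C * ((1 - r ^ 2) / (2 * r))) 1 := by
      fun_prop (disch := norm_num)
    have h2 := h1.tendsto
    norm_num at h2
    exact h2.mono_left nhdsWithin_le_nhds
  filter_upwards [hlim.eventually_lt_const (show 0 < ε.toReal / 4 by positivity),
    Ioo_mem_nhdsLT (zero_lt_one (α := ℝ))] with r hr1 hr
  have hr' : r ∈ Ico (0 : ℝ) 1 := ⟨hr.1.le, hr.2⟩
  refine alexiewiczNorm_le_of_primitive (F := poissonMean F r - F)
    (fun a b hab hle => (IsHKPrimitive.poissonInt hFc hper hF hr' hab).sub (hF a b hab hle))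
    fun a b _ _ => ?_
  rw [ENNReal.ofReal_le_iff_le_toReal hε']
  have h1 := abs_poissonMean_sub_le hFc hC H hr a
  have h2 := abs_poissonMean_sub_le hFc hC H hr b
  simp only [Pi.sub_apply]
  rw [abs_le] at h1 h2 ⊢
  constructor <;> linarith

/-! ### Part (c): arbitrarily slow decay. -/

/-- A Lebesgue integrable function is Henstock--Kurzweil integrable, with the same integral. -/
theorem IntervalIntegrable.hasIntegral_hkBox {f : ℝ → ℝ} {a b : ℝ} (h : a < b)
    (hf : IntervalIntegrable f MeasureTheory.volume a b) :
    BoxIntegral.HasIntegral (hkBox a b h) BoxIntegral.IntegrationParams.Henstock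
      (fun x : Fin 1 → ℝ => f (x 0)) BoxIntegral.BoxAdditiveMap.volume (∫ x in a..b, f x) := by
  have hmp := MeasureTheory.volume_preserving_funUnique (Fin 1) ℝ
  have hemb := (MeasurableEquiv.funUnique (Fin 1) ℝ).measurableEmbedding
  have hset : ((hkBox a b h : BoxIntegral.Box (Fin 1)) : Set (Fin 1 → ℝ)) =
      MeasurableEquiv.funUnique (Fin 1) ℝ ⁻¹' Ioc a b := by
    ext x
    constructor
    · intro hx
      exact hx 0
    · intro hx i
      obtain rfl : i = 0 := Subsingleton.elim _ _
      exact hx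
  have hint : MeasureTheory.IntegrableOn (fun x : Fin 1 → ℝ => f (x 0)) (hkBox a b h) := by
    rw [hset]
    exact (hmp.integrableOn_comp_preimage hemb).2
      ((intervalIntegrable_iff_integrableOn_Ioc_of_le h.le).1 hf)
  have key := hint.hasBoxIntegral BoxIntegral.IntegrationParams.Henstock rfl
  have hval : ∫ x in (hkBox a b h : Set (Fin 1 → ℝ)), f (x 0) = ∫ x in a..b, f x := by
    rw [hset, intervalIntegral.integral_of_le h.le]
    exact hmp.setIntegral_preimage_emb hemb f (Ioc a b)
  rwa [hval] at key

/-- An integrable density with prescribed lower bounds for its mass near the origin. -/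
theorem exists_integrable_concentrated {m ε : ℕ → ℝ} {S : ℝ} (hm : ∀ k, 0 ≤ m k)
    (hε : ∀ k, 0 < ε k) (hS : HasSum m S) :
    ∃ h : ℝ → ℝ, (∀ x, 0 ≤ h x) ∧ MeasureTheory.Integrable h ∧ ∫ x, h x = S ∧
      ∀ k, m k ≤ ∫ x in (0 : ℝ)..ε k, h x := by
  -- A block of height `m k / ε k` on `(0, ε k]` has mass `m k`. The sum of the blocks is taken in
  -- `[0, ∞]`; its integral is `S`, so it is finite almost everywhere.
  set w : ℕ → ℝ → ℝ≥0∞ := fun k => (Ioc 0 (ε k)).indicator fun _ => ENNReal.ofReal (m k / ε k)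
  have hw : ∀ k, Measurable (w k) := fun k => measurable_const.indicator measurableSet_Ioc
  set W : ℝ → ℝ≥0∞ := fun x => ∑' k, w k x
  have hW : Measurable W := Measurable.tsum fun k => hw k
  have hS0 : 0 ≤ S := hS.nonneg hm
  have hint : ∫⁻ x, W x = ENNReal.ofReal S := by
    rw [MeasureTheory.lintegral_tsum fun k => (hw k).aemeasurable, ← hS.tsum_eq,
      ENNReal.ofReal_tsum_of_nonneg hm hS.summable]
    refine tsum_congr fun k => ?_
    rw [MeasureTheory.lintegral_indicator_const measurableSet_Ioc, Real.volume_Ioc, sub_zero,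
      ← ENNReal.ofReal_mul (div_nonneg (hm k) (hε k).le), div_mul_cancel₀ _ (hε k).ne']
  have hne : ∫⁻ x, W x ≠ ∞ := by rw [hint]; exact ENNReal.ofReal_ne_top
  have hae := MeasureTheory.ae_lt_top hW hne
  have hI := MeasureTheory.integrable_toReal_of_lintegral_ne_top hW.aemeasurable hne
  refine ⟨fun x => (W x).toReal, fun x => ENNReal.toReal_nonneg, hI, ?_, fun k => ?_⟩
  · rw [MeasureTheory.integral_toReal hW.aemeasurable hae, hint, ENNReal.toReal_ofReal hS0]
  · have h1 : m k = ∫ _ in (0 : ℝ)..ε k, m k / ε k := by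
      rw [intervalIntegral.integral_const, sub_zero, smul_eq_mul, mul_div_cancel₀ _ (hε k).ne']
    conv_lhs => rw [h1]
    rw [intervalIntegral.integral_of_le (hε k).le, intervalIntegral.integral_of_le (hε k).le]
    refine MeasureTheory.setIntegral_mono_on_ae (by simp) hI.integrableOn measurableSet_Ioc ?_
    filter_upwards [hae] with x hx hxm
    have h2 : w k x ≤ W x := ENNReal.le_tsum k
    rw [show w k x = ENNReal.ofReal (m k / ε k) from indicator_of_mem hxm _,
      ENNReal.ofReal_le_iff_le_toReal hx.ne] at h2
    exact h2

/-- A nonnegative function of the space `HKCircle` with prescribed concentration at the origin. -/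
theorem exists_mem_HKCircle_concentrated {m ε : ℕ → ℝ} {S : ℝ} (hm : ∀ k, 0 ≤ m k)
    (hε : ∀ k, 0 < ε k) (hε' : ∀ k, ε k ≤ 2 * Real.pi) (hS : HasSum m S) :
    ∃ f ∈ HKCircle, ∃ F : ℝ → ℝ, ∃ c ≤ S, Continuous F ∧ Monotone F ∧
      (∀ x, F (x + 2 * Real.pi) = F x + c) ∧
      (∀ a b, a < b → b - a ≤ 2 * Real.pi → IsHKPrimitive f F a b) ∧
      ∀ k, m k ≤ F (ε k) - F 0 := by
  obtain ⟨h, h0, hI, hIS, hmk⟩ := exists_integrable_concentrated hm hε hS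
  have hT : 0 < 2 * Real.pi := Real.two_pi_pos
  set f : ℝ → ℝ := fun x => h (toIocMod hT 0 x) with hfdef
  have hfper : Function.Periodic f (2 * Real.pi) := fun x => by
    simp only [hfdef, toIocMod_add_right]
  have hfh : ∀ x ∈ Ioc 0 (2 * Real.pi), f x = h x := fun x hx => by
    have h1 : toIocMod hT 0 x = x := (toIocMod_eq_self hT).2 (by rwa [zero_add])
    simp only [hfdef, h1]
  have hf0 : ∀ x, 0 ≤ f x := fun x => h0 _
  have hfI₀ : IntervalIntegrable f MeasureTheory.volume 0 (0 + 2 * Real.pi) := by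
    rw [zero_add, intervalIntegrable_iff_integrableOn_Ioc_of_le hT.le]
    exact hI.integrableOn.congr_fun (fun x hx => (hfh x hx).symm) measurableSet_Ioc
  have hfI : ∀ a b, IntervalIntegrable f MeasureTheory.volume a b := fun a b =>
    hfper.intervalIntegrable hT.ne' hfI₀ a b
  have hfint : ∀ b, 0 ≤ b → b ≤ 2 * Real.pi → ∫ x in (0 : ℝ)..b, f x = ∫ x in (0 : ℝ)..b, h x := by
    intro b hb hb'
    rw [intervalIntegral.integral_of_le hb, intervalIntegral.integral_of_le hb]
    exact MeasureTheory.setIntegral_congr_fun measurableSet_Ioc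
      fun x hx => hfh x ⟨hx.1, hx.2.trans hb'⟩
  have htot : ∫ x in (0 : ℝ)..2 * Real.pi, f x ≤ S := by
    rw [hfint _ hT.le le_rfl, intervalIntegral.integral_of_le hT.le, ← hIS]
    exact MeasureTheory.setIntegral_le_integral hI (Eventually.of_forall h0)
  have hbox := fun (a b : ℝ) (hab : a < b) => (hfI a b).hasIntegral_hkBox hab
  have hmem : f ∈ HKCircle := by
    refine ⟨hfper, lt_of_le_of_lt ?_ (ENNReal.ofReal_lt_top (r := S))⟩
    unfold alexiewiczNorm
    refine iSup_le fun a => iSup_le fun b => iSup_le fun hab => iSup_le fun hle => ?_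
    rw [if_pos (show HKIntegrable f a b hab from (hbox a b hab).integrable),
      show hkIntegral f a b hab = ∫ x in a..b, f x from (hbox a b hab).integral_eq]
    refine ENNReal.ofReal_le_ofReal ?_
    rw [abs_of_nonneg (intervalIntegral.integral_nonneg hab.le fun x _ => hf0 x)]
    calc ∫ x in a..b, f x ≤ ∫ x in a..(a + 2 * Real.pi), f x :=
          intervalIntegral.integral_mono_interval le_rfl hab.le (by linarith)
            (Eventually.of_forall hf0) (hfI _ _)
      _ = ∫ x in (0 : ℝ)..(0 + 2 * Real.pi), f x := hfper.intervalIntegral_add_eq _ _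
      _ ≤ S := by rwa [zero_add]
  obtain ⟨F, c, hFc, hper, hF⟩ := exists_global_primitive hmem
  have hFint : ∀ a b, a < b → b - a ≤ 2 * Real.pi → F b - F a = ∫ x in a..b, f x :=
    fun a b hab hle => ((hF a b hab hle).hasIntegral hab).unique (hbox a b hab)
  refine ⟨f, hmem, F, c, ?_, hFc, ?_, hper, hF, fun k => ?_⟩
  · have h1 := hFint 0 (2 * Real.pi) hT (by simp)
    have h2 := hper 0
    rw [zero_add] at h2
    linarith
  · have hloc : ∀ x y, x ≤ y → y - x ≤ 2 * Real.pi → F x ≤ F y := by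
      intro x y hxy hle
      rcases hxy.eq_or_lt with rfl | hlt
      · exact le_rfl
      · have h1 := hFint x y hlt hle
        have h2 : 0 ≤ ∫ x in x..y, f x :=
          intervalIntegral.integral_nonneg hxy fun x _ => hf0 x
        linarith
    -- Increments of `F` are known as integrals only over at most one period, so longer intervals
    -- are crossed one period at a time.
    have hderiv : ∀ n : ℕ, ∀ x y, x ≤ y → y - x ≤ n * (2 * Real.pi) → F x ≤ F y := by
      intro n
      induction n with
      | zero =>
        intro x y hxy hle
        obtain rfl : x = y := by
          simp only [Nat.cast_zero, zero_mul] at hle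
          linarith
        exact le_rfl
      | succ n ih =>
        intro x y hxy hle
        push_cast at hle
        refine (hloc x (min y (x + 2 * Real.pi)) (le_min hxy (by linarith)) ?_).trans
          (ih _ y (min_le_left _ _) ?_)
        · linarith [min_le_right y (x + 2 * Real.pi)]
        · rcases min_cases y (x + 2 * Real.pi) with ⟨h1, -⟩ | ⟨h1, -⟩
          · rw [h1, sub_self]
            positivity
          · rw [h1]
            linarith
    intro x y hxy
    obtain ⟨n, hn⟩ := exists_nat_ge ((y - x) / (2 * Real.pi))
    exact hderiv n x y hxy ((div_le_iff₀ hT).1 hn)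
  · rw [hFint 0 (ε k) (hε k) (by simpa using hε' k), hfint _ (hε k).le (hε' k)]
    exact hmk k

/-- Translation does not change the integral over a period of the periodic part of `F`. Only the
linear part, of slope `c / (2π)`, contributes. -/
theorem integral_add_sub_of_quasiPeriodic {F : ℝ → ℝ} {c : ℝ} (hFc : Continuous F)
    (hper : ∀ x, F (x + 2 * Real.pi) = F x + c) (t : ℝ) :
    ∫ φ in (-Real.pi)..Real.pi, (F (t + φ) - F φ) = t * c := by
  have hpi := Real.pi_pos
  set k := c / (2 * Real.pi) with hk
  have hck : c = 2 * Real.pi * k := by rw [hk]; field_simp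
  set P : ℝ → ℝ := fun x => F x - k * x with hP
  have hPc : Continuous P := by fun_prop
  have hPper : Function.Periodic P (2 * Real.pi) := fun x => by
    simp only [hP, hper, hck]
    ring
  have h1 : ∫ φ in (-Real.pi)..Real.pi, P (t + φ) = ∫ φ in (-Real.pi)..Real.pi, P φ := by
    rw [intervalIntegral.integral_comp_add_left]
    have h2 := hPper.intervalIntegral_add_eq (t + -Real.pi) (-Real.pi)
    rwa [show -Real.pi + 2 * Real.pi = Real.pi by ring,
      show t + -Real.pi + 2 * Real.pi = t + Real.pi by ring] at h2
  have h3 : (fun φ => F (t + φ) - F φ) = fun φ => P (t + φ) - P φ + k * t := by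
    funext φ
    simp only [hP]
    ring
  rw [h3, intervalIntegral.integral_add, intervalIntegral.integral_sub, h1, sub_self,
    intervalIntegral.integral_const, hck, smul_eq_mul]
  · ring
  all_goals exact Continuous.intervalIntegrable (by fun_prop) _ _

/-- The increments of `F` are nonnegative, so the kernel can be replaced by its crude bound `1 / (1
- r)`, after which their integral over a period is exactly `t * c`. -/
theorem poissonMean_sub_le_of_monotone {F : ℝ → ℝ} {c : ℝ} (hFc : Continuous F) (hmono : Monotone F)
    (hper : ∀ x, F (x + 2 * Real.pi) = F x + c) {r : ℝ} (hr : r ∈ Ico (0 : ℝ) 1) {t : ℝ}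
    (ht : 0 ≤ t) : poissonMean F r t - poissonMean F r 0 ≤ t * c / (1 - r) := by
  have h1r : 0 < 1 - r := sub_pos.2 hr.2
  have hΦc := (contDiff_poissonPhi hr).continuous
  have hΦ : ∀ φ, poissonPhi r φ ≤ 1 / (1 - r) := fun φ => by
    refine (poissonPhi_le hr φ).trans ?_
    rw [div_le_div_iff₀ (mul_pos Real.two_pi_pos h1r) h1r, one_mul]
    exact mul_le_mul_of_nonneg_right (by linarith [Real.pi_gt_three, hr.2]) h1r.le
  rw [poissonMean_sub_eq hFc hr, ← integral_add_sub_of_quasiPeriodic hFc hper t, div_eq_mul_one_div,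
    ← intervalIntegral.integral_mul_const]
  refine intervalIntegral.integral_mono_on neg_pi_lt_pi.le ?_ ?_ fun φ _ => ?_
  · exact Continuous.intervalIntegrable (by fun_prop) _ _
  · exact Continuous.intervalIntegrable (by fun_prop) _ _
  · rw [zero_add]
    exact mul_le_mul_of_nonneg_left (hΦ φ) (sub_nonneg.2 (hmono (by linarith)))

theorem exists_slow_decay {A : ℝ → ℝ} (hA : AntitoneOn A (Ico (0 : ℝ) 1))
    (hlim : Tendsto A (𝓝[<] 1) (𝓝 0)) :
    ∃ f ∈ HKCircle, ∀ r ∈ Ico (0 : ℝ) 1,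
      ENNReal.ofReal (A r) ≤ alexiewiczNorm (poissonInt f r - f) := by
  -- `M` bounds `A` on `[0, 1)` by monotonicity; the summand `1` keeps it positive.
  set M := |A 0| + 1 with hM
  have hM0 : 0 < M := by positivity
  have hR : ∀ k : ℕ, ∃ ρ ∈ Ico (0 : ℝ) 1, ∀ r ∈ Ico ρ 1, A r ≤ M * (1 / 2) ^ k := by
    intro k
    have h1 := hlim.eventually_lt_const (show 0 < M * (1 / 2) ^ k by positivity)
    obtain ⟨l, hl, H⟩ := (mem_nhdsLT_iff_exists_Ioo_subset' (zero_lt_one (α := ℝ))).1 h1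
    refine ⟨(max l 0 + 1) / 2, ⟨by positivity, ?_⟩, fun r hr => (H ⟨?_, hr.2⟩).le⟩
    · have : max l 0 < 1 := max_lt hl one_pos
      linarith
    · have h2 : max l 0 < 1 := max_lt hl one_pos
      have h3 := le_max_left l 0
      have h4 := hr.1
      linarith
  choose ρ hρ hρA using hR
  have hρ1 : ∀ k, 0 < 1 - ρ k := fun k => sub_pos.2 (hρ k).2
  -- Chosen so that `ε k * (4 * M) = M * (1 / 2) ^ k * (1 - ρ (k + 1))`, where `4 * M` is the bound
  -- for the mass of `f` over one period.
  set ε : ℕ → ℝ := fun k => (1 - ρ (k + 1)) * (1 / 2) ^ k / 4 with hε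
  have hε0 : ∀ k, 0 < ε k := fun k => by
    have := hρ1 (k + 1)
    simp only [hε]
    positivity
  have hε1 : ∀ k, ε k ≤ 2 * Real.pi := fun k => by
    have h1 : (1 - ρ (k + 1)) * (1 / 2) ^ k ≤ 1 :=
      mul_le_one₀ (by linarith [(hρ (k + 1)).1]) (by positivity)
        (pow_le_one₀ (by norm_num) (by norm_num))
    simp only [hε]
    linarith [Real.pi_gt_three]
  have hsum : HasSum (fun k : ℕ => 2 * M * (1 / 2 : ℝ) ^ k) (4 * M) := by
    have h1 := hasSum_geometric_two.mul_left (2 * M)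
    rwa [show 2 * M * 2 = 4 * M by ring] at h1
  obtain ⟨f, hf, F, c, hc, hFc, hmono, hper, hF, hmass⟩ :=
    exists_mem_HKCircle_concentrated (fun k => by positivity) hε0 hε1 hsum
  refine ⟨f, hf, fun r hr => ?_⟩
  rcases le_or_gt (A r) 0 with hneg | hpos
  · rw [ENNReal.ofReal_of_nonpos hneg]
    exact zero_le
  classical
  -- Otherwise `A r ≤ M * (1 / 2) ^ (k + 1)` for all `k`, against `A r > 0`. The sequence `ρ` need
  -- not be monotone; for the least such `k`, minimality gives `ρ k ≤ r` when `k > 0`, and the bound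
  -- `M` serves when `k = 0`.
  have hex : ∃ k, r < ρ (k + 1) := by
    by_contra! hcon
    obtain ⟨k, hk⟩ := exists_pow_lt_of_lt_one (div_pos hpos hM0) (show (1 / 2 : ℝ) < 1 by norm_num)
    rw [lt_div_iff₀' hM0] at hk
    have h1 := hρA (k + 1) r ⟨hcon k, hr.2⟩
    have h2 : M * (1 / 2 : ℝ) ^ (k + 1) ≤ M * (1 / 2) ^ k :=
      mul_le_mul_of_nonneg_left (pow_le_pow_of_le_one (by norm_num) (by norm_num) k.le_succ) hM0.le
    linarith
  set k := Nat.find hex with hk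
  have hkr : r < ρ (k + 1) := Nat.find_spec hex
  have hAr : A r ≤ M * (1 / 2) ^ k := by
    rcases Nat.eq_zero_or_pos k with h0 | h0
    · have h1 := hA ⟨le_rfl, one_pos⟩ hr hr.1
      rw [h0, pow_zero, mul_one]
      linarith [le_abs_self (A 0)]
    · have h1 := Nat.find_min hex (Nat.sub_lt h0 one_pos)
      rw [← hk, show k - 1 + 1 = k by lia, not_lt] at h1
      exact hρA k r ⟨h1, hr.2⟩
  have hprim := (IsHKPrimitive.poissonInt hFc hper hF hr (hε0 k)).sub
    (hF 0 (ε k) (hε0 k) (by simpa using hε1 k))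
  refine le_trans (ENNReal.ofReal_le_ofReal ?_)
    (le_alexiewiczNorm_of_primitive (hε0 k) (by simpa using hε1 k) hprim)
  have h1 := poissonMean_sub_le_of_monotone hFc hmono hper hr (hε0 k).le
  have h2 : ε k * c / (1 - r) ≤ M * (1 / 2) ^ k := by
    rw [div_le_iff₀ (sub_pos.2 hr.2)]
    calc ε k * c ≤ ε k * (4 * M) := mul_le_mul_of_nonneg_left hc (hε0 k).le
      _ = M * (1 / 2) ^ k * (1 - ρ (k + 1)) := by simp only [hε]; ring
      _ ≤ M * (1 / 2) ^ k * (1 - r) :=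
        mul_le_mul_of_nonneg_left (by linarith) (by positivity)
  have h3 := hmass k
  simp only [Pi.sub_apply]
  -- On `[0, ε k]` the mass of `f` exceeds that of `u_r`, so the increment of the difference is used
  -- with a minus sign: `2M·2⁻ᵏ - M·2⁻ᵏ ≥ A r`.
  refine le_trans ?_ (neg_le_abs _)
  linarith

theorem mainTheorem2 :
    (∀ f ∈ HKCircle,
      -- the integrals that define the Poisson integral exist
      (∀ r ∈ Ico (0 : ℝ) 1, ∀ θ : ℝ,
        HKIntegrable (fun φ => f φ * poissonPhi r (φ - θ)) (-Real.pi) Real.pi neg_pi_lt_pi) ∧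
      -- (a)
      (∀ r ∈ Ico (0 : ℝ) 1, alexiewiczNorm (poissonInt f r) ≤ alexiewiczNorm f) ∧
      (⨆ r ∈ Ico (0 : ℝ) 1, alexiewiczNorm (poissonInt f r)) ≤ alexiewiczNorm f ∧
      -- (b)
      Tendsto (fun r : ℝ => alexiewiczNorm (poissonInt f r - f)) (𝓝[<] 1) (𝓝 0)) ∧
    -- (c)
    (∀ A : ℝ → ℝ, AntitoneOn A (Ico (0 : ℝ) 1) → Tendsto A (𝓝[<] 1) (𝓝 0) →
      ∃ f ∈ HKCircle, ∀ r ∈ Ico (0 : ℝ) 1,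
        ENNReal.ofReal (A r) ≤ alexiewiczNorm (poissonInt f r - f)) := by
  refine ⟨fun f hf => ⟨fun r hr θ => ?_, fun r hr => alexiewiczNorm_poissonInt_le hf hr,
    iSup₂_le fun r hr => alexiewiczNorm_poissonInt_le hf hr,
    tendsto_alexiewiczNorm_poissonInt_sub hf⟩, fun A hA hlim => exists_slow_decay hA hlim⟩
  obtain ⟨F, c, hFc, hper, hF⟩ := exists_global_primitive hf
  exact (poissonInt_of_primitive hFc hper (hF _ _ neg_pi_lt_pi (by linarith)) hr θ).1
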